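/- **Definitions.** For $p\in[0,1]$ let $\mathcal{B}(n,n,p)$ be the random bipartite graph with parts $A=\{1,\dots,n\}$ and $B=\{n+1,\dots,2n\}$ in which each pair $(i,j)\in A\times B$ is an edge independently with probability $p$. Let $P_{\mathcal{B}(n,n,p)}$ be the partial order on $A\cup B$ obtained as the reflexive transitive closure of the relation "$i<j$ and $ij$ is an edge" (so $x<_P y$ if and only if $x\in A$, $y\in B$ and $xy$ is an edge). A *realiser* of a partial order $P$ on a finite set $V$ is a nonempty set of total orders on $V$, each extending $P$, such that any two distinct $P$-incomparable elements $x,y$ satisfy $x<_L y$ for some member $L$ and $y<_{L'}x$ for some member $L'$; the dimension $\dim P$ is the smallest size of a realiser of $P$. An event holds asymptotically almost surely (a.a.s.) if its probability tends to $1$ as $n\to\infty$. **Theorem 2.4.** Let $p=p(n)\in[0,1]$ and $q=q(n)=1-p(n)$; all asymptotic notation is as $n\to\infty$. (a) If $q=O(1/n)$ and $1/n^2=o(q)$, then there are constants $c,C,\delta>0$ (not depending on $n$) such that a.a.s. $$c\,n^2q\le \dim P_{\mathcal{B}(n,n,p)}\le C\,n^2q ,$$ and a.a.s. $n-\dim P_{\mathcal{B}(n,n,p)}\ge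 \delta n$. (b) If $1/n=o(q)$ and $q\le n^{-1+1/7}$ for all sufficiently large $n$, then $\dim P_{\mathcal{B}(n,n,p)}=(1-o(1))n$ a.a.s.; that is, for every $\varepsilon>0$, a.a.s. $|\dim P_{\mathcal{B}(n,n,p)}-n|\le\varepsilon n$. -/

import Mathlib

/-- A set `R` of total orders on the ground set `V` of a partial order `P` is a *realiser* of `P`
if it is nonempty, every member extends `P`, and any two distinct `P`-incomparable elements occur
in both orders among the members of `R`. -/
structure IsRealiser {V : Type*} (P : PartialOrder V) (R : Finset (LinearOrder V)) : Prop where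
  nonempty : R.Nonempty
  extends_lt : ∀ i j : V, P.lt i j → ∀ L ∈ R, L.lt i j
  reverses : ∀ i j : V, i ≠ j → ¬ P.lt i j → ¬ P.lt j i →
    (∃ L ∈ R, L.lt i j) ∧ ∃ L ∈ R, L.lt j i

/-- Every partial order on a finite set has a realiser. -/
theorem exists_isRealiser {V : Type*} [Finite V] (P : PartialOrder V) :
    ∃ R : Finset (LinearOrder V), IsRealiser P R := by
  classical
  have hfin : Finite (LinearOrder V) := by
    refine Finite.of_injective (fun L : LinearOrder V => L.le) ?_
    intro L L' h
    exact LinearOrder.ext fun a b => iff_of_eq (congrFun (congrFun h a) b)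
  cases nonempty_fintype (LinearOrder V)
  have ext : ∀ r : V → V → Prop, IsPartialOrder V r → ∃ L : LinearOrder V, ∀ a b, r a b → L.le a b := by
    intro r hr
    obtain ⟨s, hs, hrs⟩ := extend_partialOrder r
    exact ⟨{ le := s, lt := fun a b => s a b ∧ ¬ s b a, lt_iff_le_not_ge := fun _ _ => Iff.rfl, le_refl := hs.refl, le_trans := hs.trans, le_antisymm := hs.antisymm,
             le_total := hs.total, toDecidableLE := Classical.decRel _ }, fun a b h => hrs a b h⟩
  have rev : ∀ i j, i ≠ j → ¬ P.lt j i → ∃ L : LinearOrder V, (∀ a b, P.le a b → L.le a b) ∧ L.lt i j := by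
    intro i j hij hji
    have hji' : ¬ P.le j i := fun h => hji (lt_of_le_of_ne h hij.symm)
    obtain ⟨L, hL⟩ := ext (fun a b => P.le a b ∨ P.le a i ∧ P.le j b)
      { refl := fun a => Or.inl (P.le_refl a)
        trans := by
          rintro a b c (h | ⟨h, h'⟩) (k | ⟨k, k'⟩)
          · exact Or.inl (P.le_trans _ _ _ h k)
          · exact Or.inr ⟨P.le_trans _ _ _ h k, k'⟩
          · exact Or.inr ⟨h, P.le_trans _ _ _ h' k⟩
          · exact Or.inr ⟨h, k'⟩
        antisymm := by
          rintro a b (h | ⟨h, h'⟩) (k | ⟨k, k'⟩)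
          · exact P.le_antisymm _ _ h k
          · exact absurd (P.le_trans _ _ _ k' (P.le_trans _ _ _ h k)) hji'
          · exact absurd (P.le_trans _ _ _ h' (P.le_trans _ _ _ k h)) hji'
          · exact absurd (P.le_trans _ _ _ h' k) hji' }
    refine ⟨L, fun a b h => hL a b (Or.inl h), ?_⟩
    exact @lt_of_le_of_ne V L.toPartialOrder i j (hL i j (Or.inr ⟨P.le_refl _, P.le_refl _⟩)) hij
  refine ⟨Finset.univ.filter fun L => ∀ a b, P.le a b → L.le a b, ?_, ?_, ?_⟩
  · obtain ⟨L, hL⟩ := ext P.le { refl := P.le_refl, trans := P.le_trans, antisymm := P.le_antisymm }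
    exact ⟨L, by simpa using hL⟩
  · intro i j h L hL
    have hle : P.le i j := le_of_lt h
    exact @lt_of_le_of_ne V L.toPartialOrder i j ((Finset.mem_filter.1 hL).2 i j hle) (ne_of_lt h)
  · intro i j hij h1 h2
    obtain ⟨L, hL, h⟩ := rev i j hij h2
    obtain ⟨L', hL', h'⟩ := rev j i hij.symm h1
    exact ⟨⟨L, by simpa using hL, h⟩, ⟨L', by simpa using hL', h'⟩⟩

/-- The (Dushnik–Miller) dimension of a partial order on a finite set: the smallest size of a
realiser. Realisers exist on a finite set, see `exists_isRealiser`. -/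
noncomputable def posetDim {V : Type*} (P : PartialOrder V) : ℕ :=
  sInf {d : ℕ | ∃ R : Finset (LinearOrder V), IsRealiser P R ∧ R.card = d}

/-- The partial order generated by a graph `G` on a linearly ordered vertex set: the reflexive
transitive closure of the relation "`i < j` and `ij` is an edge of `G`". -/
@[reducible]
def graphOrder {V : Type*} [LinearOrder V] (G : SimpleGraph V) : PartialOrder V where
  le := Relation.ReflTransGen fun i j => i < j ∧ G.Adj i j
  lt i j := Relation.ReflTransGen (fun i j => i < j ∧ G.Adj i j) i j ∧
    ¬ Relation.ReflTransGen (fun i j => i < j ∧ G.Adj i j) j i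
  lt_iff_le_not_ge _ _ := Iff.rfl
  le_refl _ := Relation.ReflTransGen.refl
  le_trans _ _ _ := Relation.ReflTransGen.trans
  le_antisymm i j hij hji := by
    have key : ∀ a b : V, Relation.ReflTransGen (fun i j => i < j ∧ G.Adj i j) a b → a ≤ b := by
      intro a b h
      induction h with
      | refl => exact le_refl _
      | tail _ h ih => exact ih.trans h.1.le
    exact le_antisymm (key _ _ hij) (key _ _ hji)

/-- The bipartite graph with parts `A`, `B`, two disjoint copies of `Fin n`, and with edge set
`E ⊆ A × B`. The vertex set `Fin n ⊕ₗ Fin n` is linearly ordered like `{1, …, 2n}`, with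
`A = {1, …, n}` placed below `B = {n + 1, …, 2n}`. -/
def bipartiteGraph (n : ℕ) (E : Set (Fin n × Fin n)) : SimpleGraph (Fin n ⊕ₗ Fin n) :=
  SimpleGraph.fromRel fun x y => ∃ e ∈ E, x = Sum.inlₗ e.1 ∧ y = Sum.inrₗ e.2

/-- The law of the edge set of the random bipartite graph `B(n, n, p)`: each pair in `A × B` is
an edge with probability `p`, independently. -/
noncomputable def bipartiteEdgeLaw (n : ℕ) (p : unitInterval) :
    MeasureTheory.Measure (Set (Fin n × Fin n)) :=
  ProbabilityTheory.setBernoulli Set.univ p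

/-- The dimension of the partial order generated by the bipartite graph with edge set `E`. -/
noncomputable def bipartiteDim (n : ℕ) (E : Set (Fin n × Fin n)) : ℕ :=
  posetDim (graphOrder (bipartiteGraph n E))

/-- Asymptotically almost surely: the probability that `B(n, n, p n)` has property `Q n` tends to
`1` as `n → ∞`. -/
def BipartiteAAS (p : ℕ → unitInterval) (Q : (n : ℕ) → Set (Fin n × Fin n) → Prop) : Prop :=
  Filter.Tendsto (fun n => bipartiteEdgeLaw n (p n) {E | Q n E}) Filter.atTop (nhds 1)

/-! Everything is read off the bipartite graph of non-edges. A realiser must put `b` below `a` in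
some member for each non-edge `(a, b)`, and one linear extension cannot reverse both `(a, b)` and
`(a', b')` when `(a, b')` and `(a', b)` are edges. Hence an induced matching of non-edges bounds the
dimension from below (`card_le_bipartiteDim`). Conversely, one extension can reverse all non-edges
at a given vertex of `A`, and two more deal with the pairs inside `A` and inside `B`
(`bipartiteDim_le`).

For (a), the isolated edges of the non-edge graph form an induced matching. Their mean number has
order `n²q`, since `p ^ n` is bounded below, and the second moment method applies. The number of
non-edges gives the upper bound. Linearly many vertices of `A` are incident to no non-edge, which
keeps the dimension away from `n`.

For (b), `n + 2` is always an upper bound. For the lower bound, the non-edges contain only `o(n)`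
4-cycles, and removing a set `Z` of few vertices of `A` destroys them. After that, the non-edges
reversed by one extension are covered by one vertex on each side (`exists_cover_of_linearOrder`). A
dimension below `(1 - ε)n` would leave linearly many uncovered vertices on both sides, spanning a
complete bipartite graph (`exists_rectangle_subset`); a union bound excludes this when `nq → ∞`. -/

/-! ### Cylinder probabilities and moment inequalities. -/

open MeasureTheory ProbabilityTheory Filter Finset in
theorem setBernoulli_real_cylinder {ι : Type*} [Finite ι] (p : unitInterval) (T S : Finset ι)
    (hd : Disjoint T S) :
    (setBernoulli Set.univ p).real {E : Set ι | (∀ i ∈ T, i ∈ E) ∧ ∀ i ∈ S, i ∉ E} =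
      (p : ℝ) ^ T.card * (1 - (p : ℝ)) ^ S.card := by
  classical
  -- In terms of indicators `ι → Prop` the event is a box, so its probability is the product of the
  -- coordinate masses.
  have hset : ((fun P : ι → Prop => {i | P i}) ⁻¹'
      {E : Set ι | (∀ i ∈ T, i ∈ E) ∧ ∀ i ∈ S, i ∉ E}) =
      Set.pi (↑(T ∪ S) : Set ι) fun i => if i ∈ T then {True} else {False} := by
    ext P
    simp only [Set.mem_preimage, Set.mem_ofPred_eq, Set.mem_pi, coe_union, Set.mem_union, mem_coe]
    constructor
    · rintro ⟨h1, h2⟩ i hi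
      by_cases hT : i ∈ T
      · simp [hT, h1 i hT]
      · simp [hT, h2 i (hi.resolve_left hT)]
    · intro h
      refine ⟨fun i hi => ?_, fun i hi => ?_⟩
      · simpa [hi] using h i (Or.inl hi)
      · have := h i (Or.inr hi)
        simpa [Finset.disjoint_right.1 hd hi] using this
  rw [measureReal_def, setBernoulli_apply', hset,
    Measure.infinitePi_pi _ (fun i _ => MeasurableSet.of_discrete), prod_union hd]
  rw [prod_congr (g := fun _ => ((unitInterval.toNNReal p : NNReal) : ENNReal)) rfl
      (fun i hi => by simp [hi]),
    prod_congr (s₁ := S) (g := fun _ => ((unitInterval.toNNReal (unitInterval.symm p) : NNReal) : ENNReal)) rfl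
      (fun i hi => by simp [Finset.disjoint_right.1 hd hi])]
  simp

open MeasureTheory ProbabilityTheory Filter Finset in
/-- Chebyshev's inequality for the number of events that occur, for a family of events any two of
which are almost uncorrelated. -/
theorem measureReal_half_le_abs_card_sub_le {Ω ι : Type*} [Finite Ω] [MeasurableSpace Ω]
    [DiscreteMeasurableSpace Ω] (μ : Measure Ω) [IsProbabilityMeasure μ] (s : Finset ι)
    (A : ι → Set Ω) [∀ ω, DecidablePred fun i => ω ∈ A i] {M η : ℝ}
    (hM : ∑ i ∈ s, μ.real (A i) = M) (hM0 : 0 < M) (hη : 0 ≤ η)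
    (h : ∀ i ∈ s, ∀ j ∈ s, i ≠ j → μ.real (A i ∩ A j) ≤ (1 + η) * (μ.real (A i) * μ.real (A j))) :
    μ.real {ω | M / 2 ≤ |((s.filter fun i => ω ∈ A i).card : ℝ) - M|} ≤ 4 * (1 / M + η) := by
  classical
  have hN : ∀ ω, ((s.filter fun i => ω ∈ A i).card : ℝ) = ∑ i ∈ s, (A i).indicator (fun _ => 1) ω := by
    intro ω
    rw [card_filter]
    push_cast
    refine sum_congr rfl fun i _ => ?_
    simp [Set.indicator_apply]
  set N : Ω → ℝ := fun ω => ∑ i ∈ s, (A i).indicator (fun _ => 1) ω with hNdef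
  have hint : ∀ f : Ω → ℝ, Integrable f μ := fun f => Integrable.of_finite
  have hI : ∀ B : Set Ω, ∫ ω, B.indicator (fun _ => (1 : ℝ)) ω ∂μ = μ.real B := by
    intro B
    exact integral_indicator_one (MeasurableSet.of_discrete)
  have h1 : ∫ ω, N ω ∂μ = M := by
    rw [hNdef, integral_finsetSum _ fun i _ => hint _, ← hM]
    exact sum_congr rfl fun i _ => hI _
  have h2 : ∫ ω, N ω ^ 2 ∂μ = ∑ i ∈ s, ∑ j ∈ s, μ.real (A i ∩ A j) := by
    have : ∀ ω, N ω ^ 2 = ∑ i ∈ s, ∑ j ∈ s, (A i ∩ A j).indicator (fun _ => (1 : ℝ)) ω := by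
      intro ω
      rw [hNdef, sq, sum_mul_sum]
      refine sum_congr rfl fun i _ => sum_congr rfl fun j _ => ?_
      by_cases hi : ω ∈ A i <;> by_cases hj : ω ∈ A j <;> simp [hi, hj]
    simp_rw [this]
    rw [integral_finsetSum _ fun i _ => hint _]
    refine sum_congr rfl fun i _ => ?_
    rw [integral_finsetSum _ fun i _ => hint _]
    exact sum_congr rfl fun j _ => hI _
  -- The diagonal gives `M`. The correlation bound is nonnegative, so it may be added on the
  -- diagonal too, which completes the double sum to `(1 + η) * M ^ 2`.
  have h3 : ∑ i ∈ s, ∑ j ∈ s, μ.real (A i ∩ A j) ≤ M + (1 + η) * M ^ 2 := by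
    calc ∑ i ∈ s, ∑ j ∈ s, μ.real (A i ∩ A j)
        ≤ ∑ i ∈ s, ∑ j ∈ s, ((if i = j then μ.real (A i) else 0) +
            (1 + η) * (μ.real (A i) * μ.real (A j))) := by
          refine sum_le_sum fun i hi => sum_le_sum fun j hj => ?_
          by_cases hij : i = j
          · subst hij
            have : 0 ≤ (1 + η) * (μ.real (A i) * μ.real (A i)) := by positivity
            simpa using this
          · simpa [hij] using h i hi j hj hij
      _ = M + (1 + η) * M ^ 2 := by
          simp only [sum_add_distrib, ← mul_sum, ← sum_mul, hM, sum_ite_eq]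
          rw [sum_congr rfl fun i hi => if_pos hi, hM]
          ring
  have h4 : ∫ ω, (N ω - M) ^ 2 ∂μ ≤ M + η * M ^ 2 := by
    have : ∀ ω, (N ω - M) ^ 2 = N ω ^ 2 - 2 * M * N ω + M ^ 2 := fun ω => by ring
    simp_rw [this]
    rw [integral_add (hint _) (hint _), integral_sub (hint _) (hint _), integral_const_mul, h1, h2]
    simp
    nlinarith
  have h5 := mul_meas_ge_le_integral_of_nonneg (μ := μ) (f := fun ω => (N ω - M) ^ 2)
    (ae_of_all _ fun ω => sq_nonneg _) (hint _) ((M / 2) ^ 2)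
  have hset : {ω | M / 2 ≤ |((s.filter fun i => ω ∈ A i).card : ℝ) - M|} =
      {ω | (M / 2) ^ 2 ≤ (N ω - M) ^ 2} := by
    ext ω
    simp only [Set.mem_ofPred_eq, hN]
    rw [← sq_abs (N ω - M), sq_le_sq₀ (by positivity) (abs_nonneg _)]
  rw [hset]
  have h6 := h5.trans h4
  have : 4 * (1 / M + η) = (M + η * M ^ 2) / (M / 2) ^ 2 := by
    field_simp
    norm_num
  rw [this, le_div_iff₀ (by positivity)]
  linarith

open MeasureTheory ProbabilityTheory Filter Finset in
/-- Markov's inequality for the number of events that occur. -/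
theorem measureReal_le_card_filter_le {Ω ι : Type*} [Finite Ω] [MeasurableSpace Ω]
    [DiscreteMeasurableSpace Ω] (μ : Measure Ω) [IsProbabilityMeasure μ] (s : Finset ι)
    (A : ι → Set Ω) [∀ ω, DecidablePred fun i => ω ∈ A i] {t : ℝ} (ht : 0 < t) :
    μ.real {ω | t ≤ ((s.filter fun i => ω ∈ A i).card : ℝ)} ≤ (∑ i ∈ s, μ.real (A i)) / t := by
  classical
  have hN : ∀ ω, ((s.filter fun i => ω ∈ A i).card : ℝ) = ∑ i ∈ s, (A i).indicator (fun _ => 1) ω := by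
    intro ω
    rw [card_filter]
    push_cast
    refine sum_congr rfl fun i _ => ?_
    simp [Set.indicator_apply]
  have h5 := mul_meas_ge_le_integral_of_nonneg (μ := μ)
    (f := fun ω => ((s.filter fun i => ω ∈ A i).card : ℝ))
    (ae_of_all _ fun ω => Nat.cast_nonneg _) Integrable.of_finite t
  have h1 : ∫ ω, ((s.filter fun i => ω ∈ A i).card : ℝ) ∂μ = ∑ i ∈ s, μ.real (A i) := by
    simp_rw [hN]
    rw [integral_finsetSum _ fun i _ => Integrable.of_finite]
    exact sum_congr rfl fun i _ => integral_indicator_one MeasurableSet.of_discrete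
  rw [h1] at h5
  rw [le_div_iff₀ ht]
  linarith

/-! ### Calculus of asymptotically almost sure events. -/

instance {n : ℕ} {p : unitInterval} :
    MeasureTheory.IsProbabilityMeasure (bipartiteEdgeLaw n p) := by
  unfold bipartiteEdgeLaw; infer_instance

open MeasureTheory Filter Topology in
theorem bipartiteAAS_of_le {p : ℕ → unitInterval} {Q : (n : ℕ) → Set (Fin n × Fin n) → Prop}
    {f : ℕ → ℝ} (hf : Tendsto f atTop (𝓝 0))
    (h : ∀ᶠ n in atTop, (bipartiteEdgeLaw n (p n)).real {E | ¬ Q n E} ≤ f n) :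
    BipartiteAAS p Q := by
  have h0 : Tendsto (fun n => (bipartiteEdgeLaw n (p n)).real {E | ¬ Q n E}) atTop (𝓝 0) :=
    tendsto_of_tendsto_of_tendsto_of_le_of_le' tendsto_const_nhds hf
      (Eventually.of_forall fun n => measureReal_nonneg) h
  have h1 : ∀ n, (bipartiteEdgeLaw n (p n)).real {E | Q n E} =
      1 - (bipartiteEdgeLaw n (p n)).real {E | ¬ Q n E} := by
    intro n
    rw [← probReal_compl_eq_one_sub MeasurableSet.of_discrete]
    congr 1
    ext E
    simp
  have h2 : Tendsto (fun n => (bipartiteEdgeLaw n (p n)).real {E | Q n E}) atTop (𝓝 1) := by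
    simp_rw [h1]
    simpa using h0.const_sub 1
  have h3 := ENNReal.tendsto_ofReal h2
  simpa [BipartiteAAS, measureReal_def] using h3

open MeasureTheory Filter Topology in
theorem BipartiteAAS.tendsto_compl {p : ℕ → unitInterval}
    {Q : (n : ℕ) → Set (Fin n × Fin n) → Prop} (h : BipartiteAAS p Q) :
    Tendsto (fun n => (bipartiteEdgeLaw n (p n)).real {E | ¬ Q n E}) atTop (𝓝 0) := by
  have h1 : ∀ n, (bipartiteEdgeLaw n (p n)).real {E | ¬ Q n E} =
      1 - (bipartiteEdgeLaw n (p n)).real {E | Q n E} := by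
    intro n
    rw [← probReal_compl_eq_one_sub MeasurableSet.of_discrete]
    congr 1
  have h2 := (ENNReal.tendsto_toReal ENNReal.one_ne_top).comp h
  simp_rw [h1]
  simpa [measureReal_def, Function.comp_def] using h2.const_sub 1

open MeasureTheory Filter Topology in
theorem BipartiteAAS.mono {p : ℕ → unitInterval} {Q Q' : (n : ℕ) → Set (Fin n × Fin n) → Prop}
    (h : BipartiteAAS p Q) (hQ : ∀ᶠ n in atTop, ∀ E, Q n E → Q' n E) : BipartiteAAS p Q' :=
  bipartiteAAS_of_le h.tendsto_compl <| hQ.mono fun _ hn =>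
    measureReal_mono fun _ hE hE' => hE (hn _ hE')

open MeasureTheory Filter Topology in
theorem BipartiteAAS.and {p : ℕ → unitInterval} {Q Q' : (n : ℕ) → Set (Fin n × Fin n) → Prop}
    (h : BipartiteAAS p Q) (h' : BipartiteAAS p Q') :
    BipartiteAAS p fun n E => Q n E ∧ Q' n E := by
  refine bipartiteAAS_of_le (by simpa using h.tendsto_compl.add h'.tendsto_compl)
    (Eventually.of_forall fun n => ?_)
  refine le_trans (measureReal_mono ?_) (measureReal_union_le _ _)
  intro E hE
  by_cases hQ : Q n E
  · exact Or.inr fun hQ' => hE ⟨hQ, hQ'⟩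
  · exact Or.inl hQ

/-! ### The bipartite order and deterministic bounds on its dimension. -/

theorem bipartiteGraph_adj_inl_inr {n : ℕ} {E : Set (Fin n × Fin n)} {a b : Fin n} :
    (bipartiteGraph n E).Adj (Sum.inlₗ a) (Sum.inrₗ b) ↔ (a, b) ∈ E := by
  simp only [bipartiteGraph, SimpleGraph.fromRel_adj]
  constructor
  · rintro ⟨-, ⟨⟨c, d⟩, he, h1, h2⟩ | ⟨⟨c, d⟩, he, h1, h2⟩⟩
    · obtain rfl : a = c := Sum.inl_injective h1
      obtain rfl : b = d := Sum.inr_injective h2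
      exact he
    · exact absurd h1 (fun h => by cases h)
  · intro h
    exact ⟨fun h => (by cases h), Or.inl ⟨_, h, rfl, rfl⟩⟩

/-- Each step leads from `A` to `B`, so no two steps compose and the transitive closure adds
nothing. -/
theorem graphOrder_bipartiteGraph_lt {n : ℕ} {E : Set (Fin n × Fin n)} {x y : Fin n ⊕ₗ Fin n} :
    (graphOrder (bipartiteGraph n E)).lt x y ↔
      ∃ e ∈ E, x = Sum.inlₗ e.1 ∧ y = Sum.inrₗ e.2 := by
  have hstep : ∀ u v : Fin n ⊕ₗ Fin n, u < v → (bipartiteGraph n E).Adj u v →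
      ∃ e ∈ E, u = Sum.inlₗ e.1 ∧ v = Sum.inrₗ e.2 := by
    intro u v huv h
    simp only [bipartiteGraph, SimpleGraph.fromRel_adj] at h
    rcases h.2 with h | ⟨e, -, rfl, rfl⟩
    · exact h
    · exact absurd huv (not_lt_of_gt (Sum.Lex.inl_lt_inr _ _))
  have hle : ∀ u v : Fin n ⊕ₗ Fin n, (graphOrder (bipartiteGraph n E)).le u v →
      u = v ∨ ∃ e ∈ E, u = Sum.inlₗ e.1 ∧ v = Sum.inrₗ e.2 := by
    intro u v h
    change Relation.ReflTransGen _ u v at h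
    induction h with
    | refl => exact Or.inl rfl
    | tail _ h ih =>
      obtain ⟨e, he, h1, h2⟩ := hstep _ _ h.1 h.2
      rcases ih with rfl | ⟨e', -, -, h4⟩
      · exact Or.inr ⟨e, he, h1, h2⟩
      · rw [h4] at h1
        cases h1
  constructor
  · intro h
    rcases hle x y h.1 with rfl | h'
    · exact absurd Relation.ReflTransGen.refl h.2
    · exact h'
  · rintro ⟨⟨a, b⟩, he, rfl, rfl⟩
    refine ⟨Relation.ReflTransGen.single ⟨Sum.Lex.inl_lt_inr _ _,
      bipartiteGraph_adj_inl_inr.2 he⟩, fun h => ?_⟩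
    rcases hle _ _ h with h | ⟨e, -, h1, -⟩
    · cases h
    · cases h1

theorem posetDim_le {V : Type*} {P : PartialOrder V} {R : Finset (LinearOrder V)}
    (hR : IsRealiser P R) : posetDim P ≤ R.card :=
  Nat.sInf_le ⟨R, hR, rfl⟩

theorem exists_isRealiser_card_eq_posetDim {V : Type*} [Finite V] (P : PartialOrder V) :
    ∃ R : Finset (LinearOrder V), IsRealiser P R ∧ R.card = posetDim P := by
  obtain ⟨R, hR⟩ := exists_isRealiser P
  exact Nat.sInf_mem (s := {d : ℕ | ∃ R, IsRealiser P R ∧ R.card = d}) ⟨_, R, hR, rfl⟩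

theorem IsRealiser.exists_inr_lt_inl {n : ℕ} {E : Set (Fin n × Fin n)}
    {R : Finset (LinearOrder (Fin n ⊕ₗ Fin n))}
    (hR : IsRealiser (graphOrder (bipartiteGraph n E)) R) {a b : Fin n} (h : (a, b) ∉ E) :
    ∃ L ∈ R, L.lt (Sum.inrₗ b) (Sum.inlₗ a) := by
  refine (hR.reverses (Sum.inlₗ a) (Sum.inrₗ b) (fun h => by cases h) ?_ ?_).2
  · rw [graphOrder_bipartiteGraph_lt]
    rintro ⟨⟨c, d⟩, he, h1, h2⟩
    obtain rfl : a = c := Sum.inl_injective h1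
    obtain rfl : b = d := Sum.inr_injective h2
    exact h he
  · rw [graphOrder_bipartiteGraph_lt]
    rintro ⟨e, -, h1, -⟩
    cases h1

theorem IsRealiser.inl_lt_inr {n : ℕ} {E : Set (Fin n × Fin n)}
    {R : Finset (LinearOrder (Fin n ⊕ₗ Fin n))}
    (hR : IsRealiser (graphOrder (bipartiteGraph n E)) R) {a b : Fin n} (h : (a, b) ∈ E)
    {L : LinearOrder (Fin n ⊕ₗ Fin n)} (hL : L ∈ R) : L.lt (Sum.inlₗ a) (Sum.inrₗ b) :=
  hR.extends_lt _ _ (graphOrder_bipartiteGraph_lt.2 ⟨_, h, rfl, rfl⟩) L hL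

/-- Two reversed non-edges alternating with two crossing edges would close such a cycle; this is the
obstruction behind the induced matching bound. -/
theorem not_alternating {V : Type*} [Preorder V] {a b c d : V} (h₁ : a < b) (h₂ : b < c)
    (h₃ : c < d) (h₄ : d < a) : False :=
  lt_irrefl _ (((h₁.trans h₂).trans h₃).trans h₄)

/-- The non-edges of a set `I` inducing a matching in the bipartite complement are reversed by
different members of a realiser. -/
theorem card_le_bipartiteDim {n : ℕ} {E : Set (Fin n × Fin n)} (I : Finset (Fin n × Fin n))
    (hI : ∀ e ∈ I, e ∉ E) (hI' : ∀ e ∈ I, ∀ f ∈ I, e ≠ f → (e.1, f.2) ∈ E) :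
    I.card ≤ bipartiteDim n E := by
  obtain ⟨R, hR, hcard⟩ := exists_isRealiser_card_eq_posetDim (graphOrder (bipartiteGraph n E))
  rw [bipartiteDim, ← hcard]
  have hch : ∀ e : Fin n × Fin n, ∃ L : LinearOrder (Fin n ⊕ₗ Fin n), e ∈ I →
      L ∈ R ∧ L.lt (Sum.inrₗ e.2) (Sum.inlₗ e.1) := by
    intro e
    by_cases he : e ∈ I
    · obtain ⟨L, h1, h2⟩ := hR.exists_inr_lt_inl (hI e he)
      exact ⟨L, fun _ => ⟨h1, h2⟩⟩
    · exact ⟨inferInstance, fun h => absurd h he⟩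
  choose F hF using hch
  refine Finset.card_le_card_of_injOn F (fun e he => (hF e he).1) ?_
  intro e he f hf hef
  by_contra hne
  have h1 := (hF e he).2
  have h2 := (hF f hf).2
  rw [← hef] at h2
  have h3 := hR.inl_lt_inr (hI' e he f hf hne) (hF e he).1
  have h4 := hR.inl_lt_inr (hI' f hf e he (Ne.symm hne)) (hF e he).1
  exact @not_alternating _ (F e).toPreorder _ _ _ _ h1 h3 h2 h4

/-- If the relation `D` between `α` and `β` contains no `4`-cycle that avoids `Z`, then those of its
pairs that avoid `Z` and are reversed by one linear extension are covered by one vertex on either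
side. -/
theorem exists_cover_of_linearOrder {α β V : Type*} [Fintype α] [Nonempty α] [Nonempty β]
    [LinearOrder V] (l : α → V) (r : β → V) (E : Set (α × β)) (Z : Set α)
    (hZ : ∀ a ∉ Z, ∀ a' ∉ Z, ∀ b b', a ≠ a' → b ≠ b' → (a, b) ∉ E → (a, b') ∉ E → (a', b) ∉ E →
      (a', b') ∈ E)
    (hL : ∀ a b, (a, b) ∈ E → l a < r b) :
    ∃ a₀ b₀, ∀ a ∉ Z, ∀ b, r b < l a → a = a₀ ∨ b = b₀ := by
  classical
  obtain ⟨i⟩ := ‹Nonempty α›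
  obtain ⟨j⟩ := ‹Nonempty β›
  by_cases hne : (Finset.univ.filter fun a => a ∉ Z).Nonempty
  swap
  · refine ⟨i, j, fun a ha => absurd ⟨a, by simpa using ha⟩ hne⟩
  obtain ⟨a₀, ha₀, hmax⟩ := Finset.exists_max_image _ l hne
  have hno : ∀ a b, r b < l a → (a, b) ∉ E := fun a b h he => lt_asymm h (hL a b he)
  have ha₀' : a₀ ∉ Z := by simpa using ha₀
  by_cases hex : ∃ a ∉ Z, a ≠ a₀ ∧ ∃ b, r b < l a
  swap
  · refine ⟨a₀, j, fun a ha b hb => Or.inl ?_⟩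
    by_contra h
    exact hex ⟨a, ha, h, b, hb⟩
  obtain ⟨a₁, ha₁, hne₁, b₁, hb₁⟩ := hex
  refine ⟨a₀, b₁, fun a ha b hb => ?_⟩
  -- Lower vertices of `A` reverse fewer pairs. So the higher of `a` and `a₁` reverses both `b` and
  -- `b₁`, as does the topmost vertex `a₀`; these four non-edges form a forbidden 4-cycle.
  by_contra! hcon
  obtain ⟨h1, h2⟩ := hcon
  have m := hmax a (by simpa using ha)
  have m₁ := hmax a₁ (by simpa using ha₁)
  rcases le_total (l a) (l a₁) with h | h
  · exact hno _ _ (hb.trans_le m) (hZ a₁ ha₁ a₀ ha₀' b₁ b hne₁ (Ne.symm h2) (hno _ _ hb₁)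
      (hno _ _ (hb.trans_le h)) (hno _ _ (hb₁.trans_le m₁)))
  · exact hno _ _ (hb.trans_le m) (hZ a ha a₀ ha₀' b₁ b h1 (Ne.symm h2) (hno _ _ (hb₁.trans_le h))
      (hno _ _ hb) (hno _ _ (hb₁.trans_le m₁)))

/-- If the non-edges that avoid `Z` contain no `4`-cycle, then a bipartite order of small dimension
contains a large complete bipartite graph. -/
theorem exists_rectangle_subset {n : ℕ} {E : Set (Fin n × Fin n)} (Z : Finset (Fin n))
    (hZ : ∀ a ∉ Z, ∀ a' ∉ Z, ∀ b b', a ≠ a' → b ≠ b' → (a, b) ∉ E → (a, b') ∉ E → (a', b) ∉ E →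
      (a', b') ∈ E) {k : ℕ} (hk : bipartiteDim n E + Z.card + k ≤ n) :
    ∃ S T : Finset (Fin n), k ≤ S.card ∧ k ≤ T.card ∧ ∀ a ∈ S, ∀ b ∈ T, (a, b) ∈ E := by
  classical
  rcases Nat.eq_zero_or_pos n with rfl | hn
  · exact ⟨∅, ∅, by simp; omega, by simp; omega, by simp⟩
  obtain ⟨R, hR, hcard⟩ := exists_isRealiser_card_eq_posetDim (graphOrder (bipartiteGraph n E))
  change R.card = bipartiteDim n E at hcard
  have hch : ∀ L : LinearOrder (Fin n ⊕ₗ Fin n), ∃ a₀ b₀ : Fin n, L ∈ R →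
      ∀ a ∉ Z, ∀ b, L.lt (Sum.inrₗ b) (Sum.inlₗ a) → a = a₀ ∨ b = b₀ := by
    intro L
    by_cases hL : L ∈ R
    · obtain ⟨a, b, h⟩ := @exists_cover_of_linearOrder (Fin n) (Fin n) _ _ ⟨⟨0, hn⟩⟩ ⟨⟨0, hn⟩⟩ L
        (fun a => Sum.inlₗ a) (fun b => Sum.inrₗ b) E Z hZ (fun a b h => hR.inl_lt_inr h hL)
      exact ⟨a, b, fun _ => h⟩
    · exact ⟨⟨0, hn⟩, ⟨0, hn⟩, fun h => absurd h hL⟩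
  choose f g hfg using hch
  have h1 : (Z ∪ R.image f).card ≤ Z.card + R.card :=
    (Finset.card_union_le _ _).trans (Nat.add_le_add_left Finset.card_image_le _)
  have h2 : (R.image g).card ≤ R.card := Finset.card_image_le
  -- A non-edge between the remaining vertices would be reversed by some member of `R`, hence met by
  -- one of its two covering vertices, which were removed.
  refine ⟨(Z ∪ R.image f)ᶜ, (R.image g)ᶜ, ?_, ?_, ?_⟩
  · rw [Finset.card_compl, Fintype.card_fin]; omega
  · rw [Finset.card_compl, Fintype.card_fin]; omega
  · intro a ha b hb
    by_contra hE
    obtain ⟨L, hL, hlt⟩ := hR.exists_inr_lt_inl hE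
    simp only [Finset.mem_compl, Finset.mem_union, Finset.mem_image, not_or, not_exists,
      not_and] at ha hb
    rcases hfg L hL a ha.1 b hlt with rfl | rfl
    · exact ha.2 L hL rfl
    · exact hb L hL rfl

/-- The linear order pulled back along an injective key. -/
@[reducible]
noncomputable def keyOrder {V κ : Type*} [LinearOrder κ] (f : V → κ) (hf : Function.Injective f) :
    LinearOrder V :=
  LinearOrder.lift' f hf

theorem keyOrder_lt {V κ : Type*} [LinearOrder κ] {f : V → κ} {hf : Function.Injective f}
    {x y : V} : (keyOrder f hf).lt x y ↔ f x < f y :=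
  Iff.rfl

/-- The linear order by a natural number attached to each element, ties being broken by the order
of `W`. -/
@[reducible]
noncomputable def blockOrder {V W : Type*} [LinearOrder W] (f : V → ℕ) (g : V ≃ W) :
    LinearOrder V :=
  keyOrder (fun v => toLex (f v, g v)) fun _ _ h => g.injective (Prod.ext_iff.1 (toLex.injective h)).2

theorem blockOrder_lt {V W : Type*} [LinearOrder W] {f : V → ℕ} {g : V ≃ W} {x y : V} :
    (blockOrder f g).lt x y ↔ f x < f y ∨ f x = f y ∧ g x < g y :=
  keyOrder_lt.trans Prod.Lex.toLex_lt_toLex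

open Classical in
theorem bipartiteDim_le {n : ℕ} {E : Set (Fin n × Fin n)} (S : Finset (Fin n))
    (hS : ∀ a b, (a, b) ∉ E → a ∈ S) : bipartiteDim n E ≤ S.card + 2 := by
  -- Two orders keep `A` below `B` and list each side in opposite directions. The order for `a` has
  -- four levels: the rest of `A`, the non-neighbours of `a`, then `a`, then its neighbours.
  set side : Fin n ⊕ₗ Fin n → ℕ := fun x => Sum.elim (fun _ => 0) (fun _ => 1) (ofLex x) with hside
  set block : Fin n → Fin n ⊕ₗ Fin n → ℕ := fun a x => Sum.elim (fun a' => if a' = a then 2 else 0)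
    (fun b => if (a, b) ∈ E then 3 else 1) (ofLex x) with hblock
  set R : Finset (LinearOrder (Fin n ⊕ₗ Fin n)) :=
    insert (blockOrder side (Equiv.refl _)) (insert (blockOrder side OrderDual.toDual)
      (S.image fun a => blockOrder (block a) (Equiv.refl _))) with hR
  refine (posetDim_le (R := R) ⟨by simp [hR], ?_, ?_⟩).trans ?_
  · intro x y hxy
    obtain ⟨⟨a, b⟩, he, rfl, rfl⟩ := graphOrder_bipartiteGraph_lt.1 hxy
    intro L hL
    simp only [hR, Finset.mem_insert, Finset.mem_image] at hL
    rcases hL with rfl | rfl | ⟨c, -, rfl⟩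
    · exact blockOrder_lt.2 (Or.inl Nat.zero_lt_one)
    · exact blockOrder_lt.2 (Or.inl Nat.zero_lt_one)
    · refine blockOrder_lt.2 (Or.inl ?_)
      change (if a = c then 2 else 0) < (if (c, b) ∈ E then 3 else 1)
      by_cases hac : a = c
      · subst hac; simp [he]
      · rw [if_neg hac]; split_ifs <;> simp
  · have hside_eq : ∀ x y : Fin n ⊕ₗ Fin n, x ≠ y → side x = side y → ∃ L ∈ R, L.lt x y := by
      intro x y hne h
      rcases lt_or_gt_of_ne hne with h' | h'
      · exact ⟨blockOrder side (Equiv.refl _), by simp [hR], blockOrder_lt.2 (Or.inr ⟨h, h'⟩)⟩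
      · exact ⟨blockOrder side OrderDual.toDual, by simp [hR], blockOrder_lt.2 (Or.inr ⟨h, h'⟩)⟩
    have key : ∀ x y : Fin n ⊕ₗ Fin n, x ≠ y → ¬ (graphOrder (bipartiteGraph n E)).lt y x →
        ∃ L ∈ R, L.lt x y := by
      intro x y hne hyx
      rcases x with a | b <;> rcases y with a' | b'
      · exact hside_eq _ _ hne rfl
      · exact ⟨blockOrder side (Equiv.refl _), by simp [hR],
          blockOrder_lt.2 (Or.inl Nat.zero_lt_one)⟩
      · have hE : (a', b) ∉ E := fun h => hyx (graphOrder_bipartiteGraph_lt.2 ⟨_, h, rfl, rfl⟩)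
        refine ⟨blockOrder (block a') (Equiv.refl _), ?_, blockOrder_lt.2 (Or.inl ?_)⟩
        · simp only [hR, Finset.mem_insert, Finset.mem_image]
          exact Or.inr (Or.inr ⟨a', hS _ _ hE, rfl⟩)
        · change (if (a', b) ∈ E then 3 else 1) < (if a' = a' then 2 else 0)
          simp [hE]
      · exact hside_eq _ _ hne rfl
    exact fun x y hne h1 h2 => ⟨key x y hne h2, key y x hne.symm h1⟩
  · refine (Finset.card_insert_le _ _).trans (Nat.succ_le_succ ?_)
    exact (Finset.card_insert_le _ _).trans (Nat.succ_le_succ Finset.card_image_le)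

/-! ### Concentration of non-edges, full vertices and isolated non-edges. -/

theorem bipartiteEdgeLaw_real_cylinder (n : ℕ) (p : unitInterval) (T S : Finset (Fin n × Fin n))
    (hd : Disjoint T S) :
    (bipartiteEdgeLaw n p).real {E | (∀ e ∈ T, e ∈ E) ∧ ∀ e ∈ S, e ∉ E} =
      (p : ℝ) ^ T.card * (1 - (p : ℝ)) ^ S.card :=
  setBernoulli_real_cylinder p T S hd

open Filter Topology MeasureTheory in
open Classical in
/-- The number of events that occur is a.a.s. of the order of its mean, if the mean tends to
infinity and any two events are almost uncorrelated. -/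
theorem bipartiteAAS_abs_card_sub_lt {p : ℕ → unitInterval} {ι : ℕ → Type} (s : ∀ n, Finset (ι n))
    (A : ∀ n, ι n → Set (Set (Fin n × Fin n))) {M η : ℕ → ℝ} (hM : Tendsto M atTop atTop)
    (hη : Tendsto η atTop (𝓝 0)) (hη0 : ∀ᶠ n in atTop, 0 ≤ η n)
    (hsum : ∀ n, ∑ i ∈ s n, (bipartiteEdgeLaw n (p n)).real (A n i) = M n)
    (h : ∀ᶠ n in atTop, ∀ i ∈ s n, ∀ j ∈ s n, i ≠ j →
      (bipartiteEdgeLaw n (p n)).real (A n i ∩ A n j) ≤ (1 + η n) *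
        ((bipartiteEdgeLaw n (p n)).real (A n i) * (bipartiteEdgeLaw n (p n)).real (A n j))) :
    BipartiteAAS p fun n E => |(((s n).filter fun i => E ∈ A n i).card : ℝ) - M n| < M n / 2 := by
  have hf : Tendsto (fun n => 4 * (1 / M n + η n)) atTop (𝓝 0) := by
    have := (hM.inv_tendsto_atTop.add hη).const_mul 4
    simpa [one_div] using this
  refine bipartiteAAS_of_le hf ?_
  filter_upwards [h, hη0, hM.eventually_gt_atTop 0] with n hn h0 hMn
  simp only [not_lt]
  exact measureReal_half_le_abs_card_sub_le _ (s n) (A n) (hsum n) hMn h0 hn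

open Filter Topology MeasureTheory in
open Classical in
theorem bipartiteAAS_card_nonedges_le {p : ℕ → unitInterval}
    (hM : Tendsto (fun n : ℕ => (n : ℝ) ^ 2 * (1 - (p n : ℝ))) atTop atTop) :
    BipartiteAAS p fun n E => ((Finset.univ.filter fun e : Fin n × Fin n => e ∉ E).card : ℝ) ≤
      2 * ((n : ℝ) ^ 2 * (1 - (p n : ℝ))) := by
  have hP : ∀ n, ∀ e : Fin n × Fin n,
      (bipartiteEdgeLaw n (p n)).real {E | e ∉ E} = 1 - (p n : ℝ) := by
    intro n e
    simpa using bipartiteEdgeLaw_real_cylinder n (p n) ∅ {e} (by simp)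
  refine (bipartiteAAS_abs_card_sub_lt (fun n => (Finset.univ : Finset (Fin n × Fin n)))
    (fun n e => {E | e ∉ E}) hM tendsto_const_nhds (Eventually.of_forall fun _ => le_rfl)
    (fun n => ?_) (Eventually.of_forall fun n e _ f _ hef => ?_)).mono ?_
  · simp only [hP, Finset.sum_const, Finset.card_univ, Fintype.card_prod, Fintype.card_fin]
    simp only [nsmul_eq_mul]
    push_cast
    ring
  · rw [hP, hP]
    have := bipartiteEdgeLaw_real_cylinder n (p n) ∅ {e, f} (by simp)
    rw [Finset.card_pair hef] at this
    refine le_of_eq ?_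
    convert this using 1
    · congr 1
      ext E; simp
    · simp only [Finset.card_empty]; ring
  · filter_upwards [hM.eventually_ge_atTop 0] with n hn E hE
    have h2 : |((Finset.univ.filter fun e : Fin n × Fin n => e ∉ E).card : ℝ) -
        (n : ℝ) ^ 2 * (1 - (p n : ℝ))| < (n : ℝ) ^ 2 * (1 - (p n : ℝ)) / 2 := by
      convert hE
    rw [abs_lt] at h2
    linarith

-- The events for distinct `a` concern disjoint rows of pairs, so they are pairwise independent and
-- Chebyshev applies with `η = 0`.
open Filter Topology MeasureTheory in
open Classical in
theorem bipartiteAAS_le_card_isolated {p : ℕ → unitInterval}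
    (hM : Tendsto (fun n : ℕ => (n : ℝ) * (p n : ℝ) ^ n) atTop atTop) :
    BipartiteAAS p fun n E => (n : ℝ) * (p n : ℝ) ^ n / 2 ≤
      ((Finset.univ.filter fun a : Fin n => ∀ b, (a, b) ∈ E).card : ℝ) := by
  have hP : ∀ n, ∀ a : Fin n,
      (bipartiteEdgeLaw n (p n)).real {E | ∀ b, (a, b) ∈ E} = (p n : ℝ) ^ n := by
    intro n a
    have := bipartiteEdgeLaw_real_cylinder n (p n) ({a} ×ˢ Finset.univ) ∅ (by simp)
    simpa using this
  refine (bipartiteAAS_abs_card_sub_lt (fun n => (Finset.univ : Finset (Fin n)))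
    (fun n a => {E | ∀ b, (a, b) ∈ E}) hM tendsto_const_nhds (Eventually.of_forall fun _ => le_rfl)
    (fun n => ?_) (Eventually.of_forall fun n a _ a' _ haa => ?_)).mono ?_
  · simp [hP]
  · rw [hP, hP]
    have := bipartiteEdgeLaw_real_cylinder n (p n) ({a, a'} ×ˢ Finset.univ) ∅ (by simp)
    rw [Finset.card_product, Finset.card_pair haa] at this
    refine le_of_eq ?_
    convert this using 1
    · congr 1
      ext E
      simp only [Set.mem_inter_iff, Set.mem_ofPred_eq, Finset.mem_product, Finset.mem_insert,
        Finset.mem_singleton, Finset.mem_univ, and_true, Prod.forall]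
      grind
    · simp only [Finset.card_empty, Finset.card_univ, Fintype.card_fin]; ring
  · refine Eventually.of_forall fun n E hE => ?_
    have h2 : |((Finset.univ.filter fun a : Fin n => ∀ b, (a, b) ∈ E).card : ℝ) -
        (n : ℝ) * (p n : ℝ) ^ n| < (n : ℝ) * (p n : ℝ) ^ n / 2 := by
      convert hE
      exact Iff.rfl
    rw [abs_lt] at h2
    linarith

open Classical in
/-- The pairs other than `e` that share a vertex with `e`. -/
noncomputable def crossOf {n : ℕ} (e : Fin n × Fin n) : Finset (Fin n × Fin n) :=
  Finset.univ.filter fun f => f ≠ e ∧ (f.1 = e.1 ∨ f.2 = e.2)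

theorem mem_crossOf {n : ℕ} {e f : Fin n × Fin n} :
    f ∈ crossOf e ↔ f ≠ e ∧ (f.1 = e.1 ∨ f.2 = e.2) := by
  simp [crossOf]

theorem card_crossOf {n : ℕ} (e : Fin n × Fin n) : (crossOf e).card = 2 * n - 2 := by
  classical
  have h1 : crossOf e = ((({e.1} : Finset (Fin n)) ×ˢ Finset.univ) ∪
      (Finset.univ ×ˢ ({e.2} : Finset (Fin n)))).erase e := by
    ext f
    simp only [mem_crossOf, Finset.mem_erase, Finset.mem_union, Finset.mem_product,
      Finset.mem_singleton, Finset.mem_univ, and_true, true_and]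
  have h2 := Finset.card_union_add_card_inter (({e.1} : Finset (Fin n)) ×ˢ Finset.univ)
    (Finset.univ ×ˢ ({e.2} : Finset (Fin n)))
  have h3 : (({e.1} : Finset (Fin n)) ×ˢ Finset.univ) ∩ (Finset.univ ×ˢ ({e.2} : Finset (Fin n))) =
      {e} := by
    ext f
    simp only [Finset.mem_inter, Finset.mem_product, Finset.mem_singleton, Finset.mem_univ,
      and_true, true_and, Prod.ext_iff]
  rw [h3] at h2
  simp only [Finset.card_product, Finset.card_singleton, Finset.card_univ, Fintype.card_fin] at h2
  rw [h1, Finset.card_erase_of_mem (by simp)]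
  omega

/-- The two crosses meet only in the corners `(e.1, f.2)` and `(f.1, e.2)`. -/
theorem le_card_crossOf_union {n : ℕ} {e f : Fin n × Fin n} (h1 : e.1 ≠ f.1) (h2 : e.2 ≠ f.2)
    [DecidableEq (Fin n × Fin n)] :
    2 * (2 * n - 2) ≤ (crossOf e ∪ crossOf f).card + 2 := by
  have h := Finset.card_union_add_card_inter (crossOf e) (crossOf f)
  have h3 : (crossOf e ∩ crossOf f).card ≤ 2 := by
    refine (Finset.card_le_card (t := {(e.1, f.2), (f.1, e.2)}) ?_).trans Finset.card_le_two
    rintro ⟨a, b⟩ hg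
    simp only [Finset.mem_inter, mem_crossOf, ne_eq, Prod.ext_iff] at hg
    simp only [Finset.mem_insert, Finset.mem_singleton, Prod.ext_iff]
    grind
  rw [card_crossOf, card_crossOf] at h
  omega

-- Second moment method for the non-edges whose whole cross consists of edges. These form an induced
-- matching in the graph of non-edges, so their number bounds the dimension from below.
open Filter Topology MeasureTheory in
open Classical in
theorem bipartiteAAS_le_bipartiteDim {p : ℕ → unitInterval}
    (hp : Tendsto (fun n => (p n : ℝ)) atTop (𝓝 1))
    (hM : Tendsto (fun n : ℕ => (n : ℝ) ^ 2 * ((p n : ℝ) ^ (2 * n - 2) * (1 - (p n : ℝ)))) atTop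
      atTop) :
    BipartiteAAS p fun n E => (n : ℝ) ^ 2 * ((p n : ℝ) ^ (2 * n - 2) * (1 - (p n : ℝ))) / 2 ≤
      bipartiteDim n E := by
  obtain ⟨A, hA⟩ : ∃ A : ∀ n : ℕ, Fin n × Fin n → Set (Set (Fin n × Fin n)),
      ∀ n e E, E ∈ A n e ↔ (∀ f ∈ crossOf e, f ∈ E) ∧ e ∉ E :=
    ⟨fun n e => {E | (∀ f ∈ crossOf e, f ∈ E) ∧ e ∉ E}, fun _ _ _ => Iff.rfl⟩
  have hP : ∀ n, ∀ e : Fin n × Fin n,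
      (bipartiteEdgeLaw n (p n)).real (A n e) = (p n : ℝ) ^ (2 * n - 2) * (1 - (p n : ℝ)) := by
    intro n e
    have := bipartiteEdgeLaw_real_cylinder n (p n) (crossOf e) {e} (by simp [mem_crossOf])
    rw [card_crossOf, Finset.card_singleton, pow_one] at this
    rw [← this]
    congr 1
    ext E
    simp only [hA, Set.mem_ofPred_eq, Finset.mem_singleton, forall_eq]
  -- Two vertex-disjoint crosses share two pairs, so the joint probability exceeds the product by a
  -- factor of at most `p⁻²`. Events whose pairs share a vertex are incompatible.
  have hη : Tendsto (fun n => ((p n : ℝ) ^ 2)⁻¹ - 1) atTop (𝓝 0) := by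
    simpa using ((hp.pow 2).inv₀ (by simp)).sub_const 1
  have hdisj : ∀ n, ∀ e f : Fin n × Fin n, ∀ E, E ∈ A n e → E ∈ A n f → e ≠ f →
      e.1 ≠ f.1 ∧ e.2 ≠ f.2 := by
    intro n e f E he hf hne
    rw [hA] at he hf
    constructor <;> intro h
    · exact hf.2 (he.1 f (mem_crossOf.2 ⟨hne.symm, Or.inl h.symm⟩))
    · exact hf.2 (he.1 f (mem_crossOf.2 ⟨hne.symm, Or.inr h.symm⟩))
  refine (bipartiteAAS_abs_card_sub_lt (fun n => (Finset.univ : Finset (Fin n × Fin n)))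
    A hM hη ?_ (fun n => ?_) ?_).mono ?_
  · filter_upwards [hp.eventually (eventually_gt_nhds zero_lt_one)] with n hn
    have : (1 : ℝ) ≤ ((p n : ℝ) ^ 2)⁻¹ :=
      (one_le_inv₀ (by positivity)).2 (pow_le_one₀ (p n).2.1 (p n).2.2)
    linarith
  · simp [hP, sq]
  · filter_upwards [hp.eventually (eventually_gt_nhds zero_lt_one)] with n hn e _ f _ hef
    rw [hP, hP]
    have hq : 0 ≤ 1 - (p n : ℝ) := sub_nonneg.2 (p n).2.2
    by_cases hd : e.1 ≠ f.1 ∧ e.2 ≠ f.2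
    · have hc := le_card_crossOf_union hd.1 hd.2
      have := bipartiteEdgeLaw_real_cylinder n (p n) (crossOf e ∪ crossOf f) {e, f} (by
        simp [mem_crossOf, Ne.symm hd.1, Ne.symm hd.2, hd.1, hd.2])
      rw [Finset.card_pair hef] at this
      have hset : A n e ∩ A n f = {E | (∀ g ∈ crossOf e ∪ crossOf f, g ∈ E) ∧
          ∀ g ∈ ({e, f} : Finset _), g ∉ E} := by
        ext E
        simp only [hA, Set.mem_inter_iff, Set.mem_ofPred_eq, Finset.mem_union, Finset.mem_insert,
          Finset.mem_singleton]
        grind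
      rw [hset, this]
      have h1 : (p n : ℝ) ^ (crossOf e ∪ crossOf f).card * (p n : ℝ) ^ 2 ≤
          (p n : ℝ) ^ (2 * n - 2) * (p n : ℝ) ^ (2 * n - 2) := by
        rw [← pow_add, ← pow_add]
        exact pow_le_pow_of_le_one hn.le (p n).2.2 (by omega)
      calc (p n : ℝ) ^ (crossOf e ∪ crossOf f).card * (1 - (p n : ℝ)) ^ 2
          = ((p n : ℝ) ^ (crossOf e ∪ crossOf f).card * (p n : ℝ) ^ 2) *
              (((p n : ℝ) ^ 2)⁻¹ * (1 - (p n : ℝ)) ^ 2) := by field_simp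
        _ ≤ ((p n : ℝ) ^ (2 * n - 2) * (p n : ℝ) ^ (2 * n - 2)) *
              (((p n : ℝ) ^ 2)⁻¹ * (1 - (p n : ℝ)) ^ 2) := by gcongr
        _ = _ := by ring
    · have : A n e ∩ A n f = ∅ := by
        ext E
        simp only [Set.mem_inter_iff, Set.mem_empty_iff_false, iff_false, not_and]
        exact fun he hf => hd (hdisj n e f E he hf hef)
      rw [this, measureReal_empty]
      have : (0 : ℝ) ≤ p n := hn.le
      rw [add_sub_cancel]
      positivity
  · refine Eventually.of_forall fun n E hE => ?_
    have h1 := (abs_lt.1 hE).1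
    have h2 : (Finset.univ.filter fun e => E ∈ A n e).card ≤ bipartiteDim n E := by
      refine card_le_bipartiteDim _ (fun e he => ((hA _ _ _).1 (Finset.mem_filter.1 he).2).2) ?_
      intro e he f hf hef
      have he' := (Finset.mem_filter.1 he).2
      obtain ⟨-, h2⟩ := hdisj n e f E he' (Finset.mem_filter.1 hf).2 hef
      exact ((hA _ _ _).1 he').1 _ (mem_crossOf.2 ⟨fun h => h2 (Prod.ext_iff.1 h).2.symm, Or.inl rfl⟩)
    have h3 : ((Finset.univ.filter fun e => E ∈ A n e).card : ℝ) ≤ bipartiteDim n E := by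
      exact_mod_cast h2
    linarith

/-! ### Part (a): the regime `q = O(1/n)`. -/

open Classical in
theorem bipartiteDim_le_card_nonedges {n : ℕ} (E : Set (Fin n × Fin n)) :
    bipartiteDim n E ≤ (Finset.univ.filter fun e : Fin n × Fin n => e ∉ E).card + 2 := by
  refine (bipartiteDim_le ((Finset.univ.filter fun e : Fin n × Fin n => e ∉ E).image Prod.fst)
    fun a b h => ?_).trans (Nat.add_le_add_right Finset.card_image_le _)
  exact Finset.mem_image.2 ⟨(a, b), by simpa using h, rfl⟩

theorem bipartiteDim_le_add_two {n : ℕ} (E : Set (Fin n × Fin n)) : bipartiteDim n E ≤ n + 2 := by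
  simpa using bipartiteDim_le (E := E) Finset.univ fun a _ _ => Finset.mem_univ a

open Classical in
theorem bipartiteDim_add_card_isolated_le {n : ℕ} (E : Set (Fin n × Fin n)) :
    bipartiteDim n E + (Finset.univ.filter fun a : Fin n => ∀ b, (a, b) ∈ E).card ≤ n + 2 := by
  have h1 := bipartiteDim_le (E := E) (Finset.univ.filter fun a : Fin n => ¬ ∀ b, (a, b) ∈ E)
    fun a b h => Finset.mem_filter.2 ⟨Finset.mem_univ _, fun h' => h (h' b)⟩
  have h2 := Finset.card_filter_add_card_filter_not (s := (Finset.univ : Finset (Fin n)))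
    (fun a : Fin n => ∀ b, (a, b) ∈ E)
  rw [Finset.card_univ, Fintype.card_fin] at h2
  omega

open Asymptotics Filter Topology in
/-- If `q = O(1/n)`, then `(1 - q)ⁿ` is bounded away from `0`. -/
theorem exists_le_pow_of_isBigO {p : ℕ → unitInterval} {q : ℕ → ℝ} (hq : ∀ n, q n = 1 - (p n : ℝ))
    (h : q =O[atTop] fun n : ℕ => 1 / (n : ℝ)) :
    ∃ γ : ℝ, 0 < γ ∧ γ ≤ 1 ∧ ∀ᶠ n in atTop, γ ≤ (p n : ℝ) ^ n := by
  obtain ⟨K, hK⟩ := h.bound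
  -- With `q ≤ K / n`, the power is at least `(1 - K / n) ^ n`, which tends to `exp (-K)`; half of
  -- this limit serves as `γ`.
  have h1 := Real.tendsto_one_add_div_pow_exp (-K)
  have h2 : Real.exp (-K) / 2 < Real.exp (-K) := half_lt_self (Real.exp_pos _)
  have hev : ∀ᶠ n in atTop, Real.exp (-K) / 2 ≤ (p n : ℝ) ^ n := by
    filter_upwards [hK, h1.eventually (eventually_gt_nhds h2), eventually_gt_atTop 0,
      tendsto_natCast_atTop_atTop.eventually_ge_atTop K] with n hn h3 h0 hKn
    have h0' : (0 : ℝ) < n := by exact_mod_cast h0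
    have h4 : q n ≤ K / n := by
      refine (le_abs_self _).trans (hn.trans_eq ?_)
      rw [Real.norm_of_nonneg (by positivity)]
      ring
    refine h3.le.trans (pow_le_pow_left₀ ?_ ?_ n)
    · rw [neg_div, ← sub_eq_add_neg, sub_nonneg, div_le_one h0']
      exact hKn
    · rw [hq] at h4
      rw [neg_div]
      linarith
  refine ⟨Real.exp (-K) / 2, by positivity, ?_, hev⟩
  obtain ⟨n, hn⟩ := hev.exists
  exact hn.trans (pow_le_one₀ (p n).2.1 (p n).2.2)

open Asymptotics Filter Topology in
theorem tendsto_mul_atTop_of_one_div_isLittleO {f : ℕ → ℝ} {q : ℕ → ℝ} (hq : ∀ n, 0 ≤ q n)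
    (hf : ∀ᶠ n in atTop, 0 < f n) (h : (fun n => 1 / f n) =o[atTop] q) :
    Tendsto (fun n => f n * q n) atTop atTop := by
  refine tendsto_atTop.2 fun b => ?_
  filter_upwards [h.bound (show 0 < 1 / (|b| + 1) by positivity), hf] with n hn hfn
  rw [Real.norm_of_nonneg (by positivity), Real.norm_of_nonneg (hq n),
    div_mul_eq_mul_div, one_mul, div_le_div_iff₀ hfn (by positivity), one_mul, mul_comm] at hn
  linarith [le_abs_self b]

open Asymptotics Filter Topology in
theorem bipartiteAAS_sparse_complement {p : ℕ → unitInterval} {q : ℕ → ℝ}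
    (hq : ∀ n, q n = 1 - (p n : ℝ)) (hO : q =O[atTop] (fun n : ℕ => 1 / (n : ℝ)))
    (ho : (fun n : ℕ => 1 / (n : ℝ) ^ 2) =o[atTop] q) :
    (∃ c C : ℝ, 0 < c ∧ 0 < C ∧ BipartiteAAS p fun n E =>
        c * ((n : ℝ) ^ 2 * q n) ≤ bipartiteDim n E ∧
          (bipartiteDim n E : ℝ) ≤ C * ((n : ℝ) ^ 2 * q n)) ∧
      ∃ δ : ℝ, 0 < δ ∧ BipartiteAAS p fun n E =>
        δ * (n : ℝ) ≤ (n : ℝ) - (bipartiteDim n E : ℝ) := by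
  classical
  obtain ⟨γ, hγ, hγ1, hpow⟩ := exists_le_pow_of_isBigO hq hO
  have hq0 : ∀ n, 0 ≤ q n := fun n => by rw [hq]; exact sub_nonneg.2 (p n).2.2
  have hnat : Tendsto (fun n : ℕ => (n : ℝ)) atTop atTop := tendsto_natCast_atTop_atTop
  have hM := tendsto_mul_atTop_of_one_div_isLittleO hq0
    ((eventually_gt_atTop 0).mono fun n hn => by positivity) ho
  have hp : Tendsto (fun n => (p n : ℝ)) atTop (𝓝 1) := by
    have h0 : Tendsto q atTop (𝓝 0) :=
      hO.trans_tendsto (by simpa using tendsto_one_div_atTop_nhds_zero_nat (𝕜 := ℝ))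
    have h1 : ∀ n, (p n : ℝ) = 1 - q n := fun n => by rw [hq]; ring
    simp_rw [h1]
    simpa using h0.const_sub 1
  have hcross : ∀ᶠ n : ℕ in atTop, γ ^ 2 * ((n : ℝ) ^ 2 * q n) ≤
      (n : ℝ) ^ 2 * ((p n : ℝ) ^ (2 * n - 2) * (1 - (p n : ℝ))) := by
    filter_upwards [hpow] with n hn
    have h1 : γ ^ 2 ≤ (p n : ℝ) ^ (2 * n - 2) := by
      calc γ ^ 2 ≤ ((p n : ℝ) ^ n) ^ 2 := by gcongr
        _ = (p n : ℝ) ^ (2 * n) := by rw [← pow_mul, mul_comm]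
        _ ≤ _ := pow_le_pow_of_le_one (p n).2.1 (p n).2.2 (Nat.sub_le _ _)
    have h2 := hq0 n
    rw [← hq]
    calc γ ^ 2 * ((n : ℝ) ^ 2 * q n) = (n : ℝ) ^ 2 * (γ ^ 2 * q n) := by ring
      _ ≤ _ := by gcongr
  constructor
  -- Half the mean number of isolated non-edges is at least `γ ^ 2 / 2` times `n²q`. At most `2n²q`
  -- non-edges occur, and the two extra extensions are absorbed by a third `n²q` once `n²q ≥ 2`.
  · refine ⟨γ ^ 2 / 2, 3, by positivity, by norm_num, ?_⟩
    have hlow := bipartiteAAS_le_bipartiteDim hp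
      (tendsto_atTop_mono' _ hcross (hM.const_mul_atTop (by positivity)))
    have hup := bipartiteAAS_card_nonedges_le (p := p) (by simpa only [hq] using hM)
    refine (hlow.and hup).mono ?_
    filter_upwards [hcross, hM.eventually_ge_atTop 2] with n hn h2 E hE
    have h3 : (bipartiteDim n E : ℝ) ≤
        ((Finset.univ.filter fun e : Fin n × Fin n => e ∉ E).card : ℝ) + 2 := by
      exact_mod_cast bipartiteDim_le_card_nonedges E
    have h4 := hE.2
    rw [← hq] at h4
    constructor
    · linarith [hE.1]
    · linarith
  -- At least `γn / 2` vertices of `A` are joined to all of `B`; the two extra extensions cost at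
  -- most `γn / 4` once `γn ≥ 8`.
  · refine ⟨γ / 4, by positivity, ?_⟩
    have hge : ∀ᶠ n : ℕ in atTop, γ * (n : ℝ) ≤ (n : ℝ) * (p n : ℝ) ^ n := by
      filter_upwards [hpow] with n hn
      rw [mul_comm]
      gcongr
    refine (bipartiteAAS_le_card_isolated
      (tendsto_atTop_mono' _ hge (hnat.const_mul_atTop hγ))).mono ?_
    filter_upwards [hge, (hnat.const_mul_atTop hγ).eventually_ge_atTop 8] with n hn h8 E hE
    have h3 : (bipartiteDim n E : ℝ) +
        ((Finset.univ.filter fun a : Fin n => ∀ b, (a, b) ∈ E).card : ℝ) ≤ n + 2 := by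
      exact_mod_cast bipartiteDim_add_card_isolated_le E
    linarith

/-! ### Part (b): 4-cycles of non-edges and complete bipartite subgraphs. -/

open Filter Topology MeasureTheory in
/-- A.a.s. few vertices of the first part lie on a `4`-cycle of non-edges. -/
theorem bipartiteAAS_exists_card_lt {p : ℕ → unitInterval} {ε : ℝ} (hε : 0 < ε)
    (h : Tendsto (fun n : ℕ => (n : ℝ) ^ 3 * (1 - (p n : ℝ)) ^ 4) atTop (𝓝 0)) :
    BipartiteAAS p fun n E => ∃ Z : Finset (Fin n), (Z.card : ℝ) ≤ ε * n ∧
      ∀ a ∉ Z, ∀ a' ∉ Z, ∀ b b', a ≠ a' → b ≠ b' → (a, b) ∉ E → (a, b') ∉ E → (a', b) ∉ E →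
        (a', b') ∈ E := by
  classical
  obtain ⟨A, hA⟩ : ∃ A : ∀ n : ℕ, (Fin n × Fin n) × (Fin n × Fin n) → Set (Set (Fin n × Fin n)),
      ∀ n x E, E ∈ A n x ↔ (x.1.1, x.2.1) ∉ E ∧ (x.1.1, x.2.2) ∉ E ∧ (x.1.2, x.2.1) ∉ E ∧
        (x.1.2, x.2.2) ∉ E :=
    ⟨fun n x => {E | (x.1.1, x.2.1) ∉ E ∧ (x.1.1, x.2.2) ∉ E ∧ (x.1.2, x.2.1) ∉ E ∧
        (x.1.2, x.2.2) ∉ E}, fun _ _ _ => Iff.rfl⟩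
  set s : ∀ n : ℕ, Finset ((Fin n × Fin n) × (Fin n × Fin n)) :=
    fun n => Finset.univ.filter fun x => x.1.1 ≠ x.1.2 ∧ x.2.1 ≠ x.2.2 with hs
  have hP : ∀ n, ∀ x ∈ s n, (bipartiteEdgeLaw n (p n)).real (A n x) = (1 - (p n : ℝ)) ^ 4 := by
    rintro n ⟨⟨a, a'⟩, b, b'⟩ hx
    obtain ⟨h1, h2⟩ : a ≠ a' ∧ b ≠ b' := by simpa [hs] using hx
    have := bipartiteEdgeLaw_real_cylinder n (p n) ∅ ({a, a'} ×ˢ {b, b'}) (by simp)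
    rw [Finset.card_product, Finset.card_pair h1, Finset.card_pair h2] at this
    norm_num at this
    rw [← this]
    congr 1
    ext E
    simp only [hA, Set.mem_ofPred_eq]
    grind
  refine bipartiteAAS_of_le (f := fun n : ℕ => (n : ℝ) ^ 3 * (1 - (p n : ℝ)) ^ 4 / ε)
    (by simpa using h.div_const ε) ?_
  filter_upwards [eventually_gt_atTop 0] with n hn
  have hn' : (0 : ℝ) < n := by exact_mod_cast hn
  have hmarkov := measureReal_le_card_filter_le (bipartiteEdgeLaw n (p n)) (s n) (A n)
    (t := ε * n) (by positivity)
  have hcard : ((s n).card : ℝ) ≤ (n : ℝ) ^ 4 := by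
    have : (s n).card ≤ n ^ 4 := by
      refine (Finset.card_le_univ _).trans_eq ?_
      simp only [Fintype.card_prod, Fintype.card_fin]
      ring
    exact_mod_cast this
  refine (measureReal_mono ?_).trans (hmarkov.trans ?_)
  · intro E hE
    by_contra hlt
    -- `Z` takes the first `A`-vertex of every labelled 4-cycle of non-edges, so its size is at most
    -- their number.
    refine hE ⟨((s n).filter fun x => E ∈ A n x).image fun x => x.1.1, ?_, ?_⟩
    · refine le_trans ?_ (not_le.1 hlt).le
      exact_mod_cast Finset.card_image_le
    · intro a ha a' _ b b' haa hbb h1 h2 h3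
      by_contra h4
      refine ha (Finset.mem_image.2 ⟨((a, a'), (b, b')), ?_, rfl⟩)
      exact Finset.mem_filter.2 ⟨by simp [hs, haa, hbb], (hA _ _ _).2 ⟨h1, h2, h3, h4⟩⟩
  · have h0 : 0 ≤ 1 - (p n : ℝ) := sub_nonneg.2 (p n).2.2
    rw [Finset.sum_congr rfl (hP n), Finset.sum_const, nsmul_eq_mul,
      div_le_div_iff₀ (by positivity) hε]
    calc ((s n).card : ℝ) * (1 - (p n : ℝ)) ^ 4 * ε ≤ (n : ℝ) ^ 4 * (1 - (p n : ℝ)) ^ 4 * ε := by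
          gcongr
      _ = _ := by ring

open Filter Topology MeasureTheory in
/-- A.a.s. there is no large complete bipartite subgraph. -/
theorem bipartiteAAS_not_exists_rectangle {p : ℕ → unitInterval} {ε : ℝ} (hε : 0 < ε)
    (h : Tendsto (fun n : ℕ => (n : ℝ) * (1 - (p n : ℝ))) atTop atTop) :
    BipartiteAAS p fun n E => ¬ ∃ S T : Finset (Fin n), ⌈ε * n⌉₊ ≤ S.card ∧ ⌈ε * n⌉₊ ≤ T.card ∧
      ∀ a ∈ S, ∀ b ∈ T, (a, b) ∈ E := by
  classical
  have hlim : Tendsto (fun n : ℕ => Real.exp (-(n : ℝ))) atTop (𝓝 0) :=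
    Real.tendsto_exp_neg_atTop_nhds_zero.comp tendsto_natCast_atTop_atTop
  refine bipartiteAAS_of_le hlim ?_
  -- This threshold makes `q(εn)² ≥ (1 + log 4)n`, so the union bound over at most `4 ^ n` pairs
  -- `(S, T)` still leaves `exp (-n)`.
  filter_upwards [h.eventually_ge_atTop ((1 + Real.log 4) / ε ^ 2)] with n hn
  rw [div_le_iff₀ (by positivity)] at hn
  have hp0 : (0 : ℝ) ≤ p n := (p n).2.1
  have hp1 : (p n : ℝ) ≤ 1 := (p n).2.2
  set U : Finset (Finset (Fin n) × Finset (Fin n)) :=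
    Finset.univ.filter fun x => ⌈ε * n⌉₊ ≤ x.1.card ∧ ⌈ε * n⌉₊ ≤ x.2.card with hU
  have hsub : {E : Set (Fin n × Fin n) | ¬ ¬ ∃ S T : Finset (Fin n), ⌈ε * n⌉₊ ≤ S.card ∧
      ⌈ε * n⌉₊ ≤ T.card ∧ ∀ a ∈ S, ∀ b ∈ T, (a, b) ∈ E} ⊆
      ⋃ x ∈ U, {E | (∀ e ∈ x.1 ×ˢ x.2, e ∈ E) ∧ ∀ e ∈ (∅ : Finset (Fin n × Fin n)), e ∉ E} := by
    intro E hE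
    obtain ⟨S, T, hS, hT, hST⟩ := not_not.1 hE
    simp only [Set.mem_iUnion]
    refine ⟨(S, T), Finset.mem_filter.2 ⟨Finset.mem_univ _, hS, hT⟩, fun e he => ?_, by simp⟩
    rw [Finset.mem_product] at he
    exact hST _ he.1 _ he.2
  have hx : ∀ x ∈ U, (bipartiteEdgeLaw n (p n)).real
      {E | (∀ e ∈ x.1 ×ˢ x.2, e ∈ E) ∧ ∀ e ∈ (∅ : Finset (Fin n × Fin n)), e ∉ E} ≤
      (p n : ℝ) ^ (⌈ε * n⌉₊ * ⌈ε * n⌉₊) := by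
    intro x hx
    obtain ⟨h1, h2⟩ : ⌈ε * n⌉₊ ≤ x.1.card ∧ ⌈ε * n⌉₊ ≤ x.2.card := (Finset.mem_filter.1 hx).2
    rw [bipartiteEdgeLaw_real_cylinder _ _ _ _ (by simp), Finset.card_product, Finset.card_empty,
      pow_zero, mul_one]
    exact pow_le_pow_of_le_one hp0 hp1 (Nat.mul_le_mul h1 h2)
  have hcard : (U.card : ℝ) ≤ Real.exp (n * Real.log 4) := by
    have h1 : U.card ≤ 4 ^ n := by
      refine (Finset.card_le_univ _).trans_eq ?_
      simp only [Fintype.card_prod, Fintype.card_finset, Fintype.card_fin]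
      rw [← mul_pow]
      norm_num
    rw [mul_comm, Real.exp_mul, Real.exp_log (by norm_num), Real.rpow_natCast]
    exact_mod_cast h1
  have hpow : (p n : ℝ) ^ (⌈ε * n⌉₊ * ⌈ε * n⌉₊) ≤
      Real.exp (-((1 - (p n : ℝ)) * ((ε * n) * (ε * n)))) := by
    calc (p n : ℝ) ^ (⌈ε * n⌉₊ * ⌈ε * n⌉₊)
        ≤ Real.exp (-(1 - (p n : ℝ))) ^ (⌈ε * n⌉₊ * ⌈ε * n⌉₊) := by
          refine pow_le_pow_left₀ hp0 ?_ _
          have := Real.add_one_le_exp (-(1 - (p n : ℝ)))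
          linarith
      _ = Real.exp (-((1 - (p n : ℝ)) * ((⌈ε * n⌉₊ : ℝ) * (⌈ε * n⌉₊ : ℝ)))) := by
          rw [← Real.exp_nat_mul]
          congr 1
          push_cast
          ring
      _ ≤ _ := by
          have h0 : 0 ≤ 1 - (p n : ℝ) := sub_nonneg.2 hp1
          have h1 := Nat.le_ceil (ε * n)
          gcongr
  calc _ ≤ _ := measureReal_mono hsub (measure_ne_top _ _)
    _ ≤ _ := measureReal_biUnion_finset_le _ _
    _ ≤ U.card • _ := Finset.sum_le_card_nsmul _ _ _ hx
    _ = (U.card : ℝ) * (p n : ℝ) ^ (⌈ε * n⌉₊ * ⌈ε * n⌉₊) := nsmul_eq_mul _ _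
    _ ≤ Real.exp (n * Real.log 4) * Real.exp (-((1 - (p n : ℝ)) * ((ε * n) * (ε * n)))) := by
        gcongr
    _ = Real.exp (n * Real.log 4 - (1 - (p n : ℝ)) * ((ε * n) * (ε * n))) := by
        rw [← Real.exp_add, ← sub_eq_add_neg]
    _ ≤ Real.exp (-(n : ℝ)) := by
        refine Real.exp_le_exp.2 ?_
        have := mul_le_mul_of_nonneg_left hn (Nat.cast_nonneg (α := ℝ) n)
        nlinarith

open Asymptotics Filter Topology in
theorem bipartiteAAS_abs_bipartiteDim_sub_le {p : ℕ → unitInterval} {q : ℕ → ℝ}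
    (hq : ∀ n, q n = 1 - (p n : ℝ)) (ho : (fun n : ℕ => 1 / (n : ℝ)) =o[atTop] q)
    (hle : ∀ᶠ n : ℕ in atTop, q n ≤ (n : ℝ) ^ (-1 + 1 / 7 : ℝ)) {ε : ℝ} (hε : 0 < ε) :
    BipartiteAAS p fun n E => |(bipartiteDim n E : ℝ) - (n : ℝ)| ≤ ε * (n : ℝ) := by
  have hq0 : ∀ n, 0 ≤ q n := fun n => by rw [hq]; exact sub_nonneg.2 (p n).2.2
  have hnat : Tendsto (fun n : ℕ => (n : ℝ)) atTop atTop := tendsto_natCast_atTop_atTop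
  have hM := tendsto_mul_atTop_of_one_div_isLittleO hq0
    ((eventually_gt_atTop 0).mono fun n hn => by positivity) ho
  -- This says that the mean number of 4-cycles, at most `n⁴q⁴`, is `o(n)`. The exponent is `3 - 4 ·
  -- 6/7 = -3/7`.
  have hcyc : Tendsto (fun n : ℕ => (n : ℝ) ^ 3 * q n ^ 4) atTop (𝓝 0) := by
    refine squeeze_zero' (Eventually.of_forall fun n => mul_nonneg (by positivity)
      (pow_nonneg (hq0 n) _)) ?_ ((tendsto_rpow_neg_atTop (y := 3 / 7) (by norm_num)).comp hnat)
    filter_upwards [hle, eventually_gt_atTop 0] with n hn h0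
    have h0' : (0 : ℝ) < n := by exact_mod_cast h0
    calc (n : ℝ) ^ 3 * q n ^ 4 ≤ (n : ℝ) ^ 3 * ((n : ℝ) ^ (-1 + 1 / 7 : ℝ)) ^ 4 := by
          have := hq0 n
          gcongr
      _ = (n : ℝ) ^ (-(3 / 7) : ℝ) := by
          rw [← Real.rpow_natCast, ← Real.rpow_natCast, ← Real.rpow_mul h0'.le,
            ← Real.rpow_add h0']
          norm_num
  have h1 := bipartiteAAS_exists_card_lt (p := p) (show 0 < ε / 4 by positivity)
    (by simpa only [hq] using hcyc)
  have h2 := bipartiteAAS_not_exists_rectangle (p := p) (show 0 < ε / 4 by positivity)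
    (by simpa only [hq] using hM)
  refine (h1.and h2).mono ?_
  filter_upwards [(hnat.const_mul_atTop hε).eventually_ge_atTop 2] with n hn E hE
  obtain ⟨⟨Z, hZ, hZ'⟩, hrect⟩ := hE
  have hup : (bipartiteDim n E : ℝ) ≤ n + 2 := by exact_mod_cast bipartiteDim_le_add_two E
  rw [abs_le]
  refine ⟨?_, by linarith⟩
  by_contra! hlt
  refine hrect (exists_rectangle_subset Z hZ' ?_)
  -- `Z` and the rectangle side each cost `εn / 4`, and rounding up costs 1; the total is at most
  -- `εn` because `εn ≥ 2`.
  have hceil := (Nat.ceil_lt_add_one (show 0 ≤ ε / 4 * n by positivity)).le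
  have : (bipartiteDim n E : ℝ) + Z.card + (⌈ε / 4 * n⌉₊ : ℝ) ≤ n := by linarith
  exact_mod_cast this

open Asymptotics Filter in
theorem theorem2p4 (p : ℕ → unitInterval) (q : ℕ → ℝ) (hq : ∀ n, q n = 1 - (p n : ℝ)) :
    (q =O[atTop] (fun n : ℕ => 1 / (n : ℝ)) → (fun n : ℕ => 1 / (n : ℝ) ^ 2) =o[atTop] q →
      (∃ c C : ℝ, 0 < c ∧ 0 < C ∧ BipartiteAAS p fun n E =>
        c * ((n : ℝ) ^ 2 * q n) ≤ bipartiteDim n E ∧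
          (bipartiteDim n E : ℝ) ≤ C * ((n : ℝ) ^ 2 * q n)) ∧
      (∃ δ : ℝ, 0 < δ ∧ BipartiteAAS p fun n E =>
        δ * (n : ℝ) ≤ (n : ℝ) - (bipartiteDim n E : ℝ))) ∧
    ((fun n : ℕ => 1 / (n : ℝ)) =o[atTop] q →
      (∀ᶠ n : ℕ in atTop, q n ≤ (n : ℝ) ^ (-1 + 1 / 7 : ℝ)) →
      ∀ ε : ℝ, 0 < ε → BipartiteAAS p fun n E =>
        |(bipartiteDim n E : ℝ) - (n : ℝ)| ≤ ε * (n : ℝ)) :=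
  ⟨fun hO ho => bipartiteAAS_sparse_complement hq hO ho, fun ho hle _ hε =>
    bipartiteAAS_abs_bipartiteDim_sub_le hq ho hle hε⟩
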